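/- Let $n\ge 0$, $A\ge 1$ and $p\ge 1$ be integers with $n$ even and $A\le 2$. Write $(k)_{n+1}=k(k+1)\cdots(k+n)$. Let $P\in\mathbb{Q}[X_1,\dots,X_p]$ be a polynomial of degree at most $A(n+1)-2$ in each of its variables (the zero polynomial being allowed in all cases) such that $$P(X_{\sigma(1)},\dots,X_{\sigma(p)})=\varepsilon_\sigma\,P(X_1,\dots,X_p)\quad\text{for every }\sigma\in\mathfrak{S}_p,$$ where $\varepsilon_\sigma$ is the signature of $\sigma$, and $$P(X_1,\dots,X_{j-1},-X_j-n,X_{j+1},\dots,X_p)=(-1)^{A(n+1)+1}P(X_1,\dots,X_p)\quad\text{for every }j\in\{1,\dots,p\}.$$ Then the series $$\sum_{k_1\ge k_2\ge\cdots\ge k_p\ge 1}\frac{P(k_1,\dots,k_p)}{(k_1)_{n+1}^{A}\cdots(k_p)_{n+1}^{A}}$$ converges absolutely, and its sum is a polynomial in $\zeta(3)$ with rational coefficients, i.e. it equals $Q(\zeta(3))$ for some $Q\in\mathbb{Q}[X]$. -/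

import Mathlib

/-- The set of polynomials `P ∈ ℚ[X₁, …, X_p]` which are alternating under permutation of the
variables and which are multiplied by `(-1)^(A(n+1)+1)` when any single variable `X_j` is
replaced by `-X_j - n`, the other variables being left unchanged. -/
def wellPoisedPolynomials (n A p : ℕ) : Set (MvPolynomial (Fin p) ℚ) :=
  {P | (∀ σ : Equiv.Perm (Fin p),
          MvPolynomial.rename σ P = ((Equiv.Perm.sign σ : ℤˣ) : ℤ) • P) ∧
       (∀ j : Fin p,
          MvPolynomial.bind₁
              (Function.update (MvPolynomial.X : Fin p → MvPolynomial (Fin p) ℚ) j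
                (-MvPolynomial.X j - MvPolynomial.C (n : ℚ))) P
            = (-1) ^ (A * (n + 1) + 1) * P)}

/-- The index set of the series: the `p`-tuples of integers with `k₁ ≥ … ≥ k_p ≥ 1`. -/
def orderedTuples (p : ℕ) : Set (Fin p → ℕ) :=
  {k | Antitone k ∧ ∀ i, 1 ≤ k i}

/-- The general term `P(k₁, …, k_p) / ((k₁)_{n+1}^A ⋯ (k_p)_{n+1}^A)`, where
`(k)_{n+1} = k (k+1) ⋯ (k+n)`. -/
noncomputable def seriesTerm (n A p : ℕ) (P : MvPolynomial (Fin p) ℚ) (k : Fin p → ℕ) : ℂ :=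
  MvPolynomial.aeval (fun i => (k i : ℂ)) P /
    ∏ i, ((ascPochhammer ℂ (n + 1)).eval (k i : ℂ)) ^ A

/-! Because `P` is alternating and has bounded degree in each variable, the general term is `M (v
k₁, …, v k_p)`, where `M` is an alternating multilinear form and the coordinates of `v k` are
one-variable fractions. The symmetry of `P` in each variable allows these fractions to be chosen odd
in `x = k + n / 2`. The truncated series is then a linear functional of the sum of `ω(k₁) ∧ ⋯ ∧
ω(k_p)` over ordered tuples.

Products of two vectors commute in the exterior algebra, which collapses this sum (`wedgeSum_eq`):
with `S₁ = ∑ ω(k)` and `S₂ = ∑_{k ≥ l} ω(k) ∧ ω(l)`, it equals `S₂ ^ q / q!` for `p = 2 q` and `S₁ ∧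
S₂ ^ q / q!` for `p = 2 q + 1`. Only sums of depth one and antisymmetrized sums of depth two remain.

Let `f` be an odd fraction which is `O(x⁻²)`, with integer poles of order at most two. Its residues
sum to zero, and oddness kills the double-pole contribution, so `f x = F (x - 1) - F x` with `F (-1
- x) = F x` (`IsFrac.hasPrimitive_of_odd`): depth one telescopes to a rational number. In depth two,
for `f` and `g` with primitives `F` and `G`, summation by parts leaves the single sum of `F x * G (x
- 1) - F (x - 1) * G x` (`HasPrimitive.antisymm_pair_sum_mem_zetaSeq`). This fraction is odd with
poles of order at most four, so `ζ(3)` is the only zeta value it can produce. -/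

open ExteriorAlgebra in
/-- The sum of `ω(k₁) ∧ ⋯ ∧ ω(k_p)` over `N ≥ k₁ ≥ ⋯ ≥ k_p ≥ 1`, where `ω k = ι (v k)`. -/
noncomputable def wedgeSum {W : Type*} [AddCommGroup W] [Module ℚ W] (v : ℕ → W) :
    ℕ → ℕ → ExteriorAlgebra ℚ W
  | 0, _ => 1
  | p + 1, N => ∑ j ∈ Finset.Icc 1 N, ι ℚ (v j) * wedgeSum v p j

/-! ### Ordered sums in the exterior algebra -/

section WedgeSum

open ExteriorAlgebra Finset

variable {W : Type*} [AddCommGroup W] [Module ℚ W]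

theorem ExteriorAlgebra.ι_mul_ι_comm (x y : W) : ι ℚ x * ι ℚ y = -(ι ℚ y * ι ℚ x) :=
  eq_neg_of_add_eq_zero_left (ι_add_mul_swap x y)

theorem ExteriorAlgebra.ι_mul_ι_commute (x y z : W) : Commute (ι ℚ x * ι ℚ y) (ι ℚ z) := by
  unfold Commute SemiconjBy
  rw [mul_assoc, ι_mul_ι_comm y z, mul_neg, ← mul_assoc, ι_mul_ι_comm x z, neg_mul, neg_neg,
    mul_assoc]

/-- The sum of `ω(k) ∧ ω(l)` over `N ≥ k ≥ l ≥ 1`, where `ω k = ι (v k)`. -/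
noncomputable def wedgePairSum (v : ℕ → W) (N : ℕ) : ExteriorAlgebra ℚ W :=
  ∑ j ∈ Icc 1 N, ι ℚ (v j) * ι ℚ (∑ l ∈ Icc 1 j, v l)

theorem wedgePairSum_commute_ι (v : ℕ → W) (N : ℕ) (z : W) :
    Commute (wedgePairSum v N) (ι ℚ z) :=
  Commute.sum_left _ _ _ fun _ _ => ι_mul_ι_commute _ _ _

/-- Binomial formula cut off by `b ^ 2 = 0`. It is meant for `b` the increment of `wedgePairSum`
from `N` to `N + 1`. -/
theorem pow_succ_add_of_sq_zero {R : Type*} [Ring R] {a b : R} (h : Commute a b)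
    (hb : b * b = 0) (q : ℕ) :
    b * (a + b) ^ q = b * a ^ q ∧
      (a + b) ^ (q + 1) = a ^ (q + 1) + ((q + 1 : ℕ) : R) * (b * a ^ q) := by
  have h1 : ∀ q : ℕ, b * (a + b) ^ q = b * a ^ q := by
    intro q
    induction q with
    | zero => simp
    | succ q ih =>
      rw [pow_succ', ← mul_assoc, mul_add, hb, add_zero, ← h.eq, mul_assoc, ih, ← mul_assoc, h.eq,
        mul_assoc, ← pow_succ']
  refine ⟨h1 q, ?_⟩
  induction q with
  | zero => simp
  | succ q ih =>
    rw [pow_succ' (a + b), add_mul, h1, ih, mul_add, ← pow_succ', ← mul_assoc a,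
      ← Nat.cast_commute, mul_assoc, ← mul_assoc a, h.eq, mul_assoc b, ← pow_succ']
    push_cast
    noncomm_ring

theorem wedgeSum_succ_succ (v : ℕ → W) (p N : ℕ) :
    wedgeSum v (p + 1) (N + 1) =
      wedgeSum v (p + 1) N + ι ℚ (v (N + 1)) * wedgeSum v p (N + 1) :=
  sum_Icc_succ_top (by omega) _

/-- The diagonal term `l = N + 1` drops out since a vector squares to zero; this is why `k ≥ l` and
`k > l` give the same sum. -/
theorem wedgePairSum_succ (v : ℕ → W) (N : ℕ) :
    wedgePairSum v (N + 1) =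
      wedgePairSum v N + ι ℚ (v (N + 1)) * ι ℚ (∑ l ∈ Icc 1 N, v l) := by
  rw [wedgePairSum, sum_Icc_succ_top (by omega), ← wedgePairSum, sum_Icc_succ_top (by omega),
    map_add, mul_add, ι_sq_zero, add_zero]

theorem ExteriorAlgebra.ι_mul_ι_sq (x y : W) : ι ℚ x * ι ℚ y * (ι ℚ x * ι ℚ y) = 0 := by
  rw [← mul_assoc, (ι_mul_ι_commute x y x).eq, ← mul_assoc, ι_sq_zero, zero_mul, zero_mul]

theorem wedgePairSum_pow_succ (v : ℕ → W) (q N : ℕ) :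
    ι ℚ (v (N + 1)) * ι ℚ (∑ l ∈ Icc 1 N, v l) * wedgePairSum v (N + 1) ^ q =
        ι ℚ (v (N + 1)) * ι ℚ (∑ l ∈ Icc 1 N, v l) * wedgePairSum v N ^ q ∧
      wedgePairSum v (N + 1) ^ (q + 1) = wedgePairSum v N ^ (q + 1) +
        ((q + 1 : ℕ) : ExteriorAlgebra ℚ W) *
          (ι ℚ (v (N + 1)) * ι ℚ (∑ l ∈ Icc 1 N, v l) * wedgePairSum v N ^ q) := by
  rw [wedgePairSum_succ]
  exact pow_succ_add_of_sq_zero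
    ((wedgePairSum_commute_ι v N _).mul_right (wedgePairSum_commute_ι v N _)) (ι_mul_ι_sq _ _) q

/-- Both sides vanish or agree at `N = 0` and have the same increment in `N`. For each `q` the odd
identity follows from the even one, and the next even identity from the odd one. -/
theorem wedgeSum_eq (v : ℕ → W) (q N : ℕ) :
    (q.factorial : ℚ) • wedgeSum v (2 * q) N = wedgePairSum v N ^ q ∧
      (q.factorial : ℚ) • wedgeSum v (2 * q + 1) N =
        ι ℚ (∑ l ∈ Icc 1 N, v l) * wedgePairSum v N ^ q := by
  have hodd : ∀ q, (∀ N, (q.factorial : ℚ) • wedgeSum v (2 * q) N = wedgePairSum v N ^ q) →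
      ∀ N, (q.factorial : ℚ) • wedgeSum v (2 * q + 1) N =
        ι ℚ (∑ l ∈ Icc 1 N, v l) * wedgePairSum v N ^ q := by
    intro q hq N
    induction N with
    | zero => simp [wedgeSum]
    | succ N ih =>
      rw [wedgeSum_succ_succ, smul_add, ih, ← mul_smul_comm, hq,
        sum_Icc_succ_top (by omega : 1 ≤ N + 1), map_add, add_mul]
      congr 1
      cases q with
      | zero => simp
      | succ q =>
        -- The increment of the power contains the factor `ι (∑ l ∈ Icc 1 N, v l)`, so multiplying
        -- by this same vector kills it.
        rw [(wedgePairSum_pow_succ v q N).2, mul_add, ← mul_assoc _ (Nat.cast _) _,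
          ← (Nat.cast_commute _ _).eq, mul_assoc (Nat.cast _), ← mul_assoc (ι ℚ (∑ l ∈ Icc 1 N, v l)),
          ← (ι_mul_ι_commute _ _ _).eq, mul_assoc (ι ℚ (v (N + 1))), ι_sq_zero]
        simp
  have heven : ∀ q N, (q.factorial : ℚ) • wedgeSum v (2 * q) N = wedgePairSum v N ^ q := by
    intro q
    induction q with
    | zero => intro N; simp [wedgeSum]
    | succ q ihq =>
      intro N
      induction N with
      | zero => simp [wedgeSum, wedgePairSum, Nat.mul_succ]
      | succ N ih =>
        have e : wedgeSum v (2 * (q + 1)) (N + 1) = wedgeSum v (2 * (q + 1)) N +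
            ι ℚ (v (N + 1)) * wedgeSum v (2 * q + 1) (N + 1) := wedgeSum_succ_succ v (2 * q + 1) N
        obtain ⟨h1, h2⟩ := wedgePairSum_pow_succ v q N
        rw [e, smul_add, ih, ← mul_smul_comm, Nat.factorial_succ, Nat.cast_mul, mul_smul,
          hodd q ihq, sum_Icc_succ_top (by omega : 1 ≤ N + 1), map_add, h2, mul_smul_comm,
          ← mul_assoc, mul_add, ι_sq_zero, add_zero, h1, ← nsmul_eq_mul,
          ← Nat.cast_smul_eq_nsmul ℚ]
  exact ⟨heven q N, hodd q (heven q) N⟩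

/-- The tuples `N ≥ k₁ ≥ ⋯ ≥ k_p ≥ 1`. -/
def antitoneBox (p N : ℕ) : Finset (Fin p → ℕ) :=
  open Classical in (Fintype.piFinset fun _ => Icc 1 N).filter Antitone

theorem mem_antitoneBox {p N : ℕ} {k : Fin p → ℕ} :
    k ∈ antitoneBox p N ↔ (∀ i, 1 ≤ k i ∧ k i ≤ N) ∧ Antitone k := by
  simp [antitoneBox]

theorem Fin.antitone_cons {p : ℕ} {j : ℕ} {k : Fin p → ℕ} :
    Antitone (Fin.cons j k : Fin (p + 1) → ℕ) ↔ (∀ i, k i ≤ j) ∧ Antitone k := by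
  constructor
  · intro h
    refine ⟨fun i => by simpa using h (Fin.zero_le i.succ), fun a b hab => ?_⟩
    simpa using h (Fin.succ_le_succ_iff.2 hab)
  · rintro ⟨h1, h2⟩ a b hab
    induction a using Fin.cases with
    | zero =>
      induction b using Fin.cases with
      | zero => simp
      | succ b => simpa using h1 b
    | succ a =>
      induction b using Fin.cases with
      | zero => simp at hab
      | succ b => simpa using h2 (Fin.succ_le_succ_iff.1 hab)

/-- The recursion peels off the first, largest index, which becomes the upper bound for the
remaining ones. -/
theorem wedgeSum_eq_sum_antitoneBox (v : ℕ → W) (p N : ℕ) :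
    wedgeSum v p N = ∑ k ∈ antitoneBox p N, ιMulti ℚ p fun i => v (k i) := by
  induction p generalizing N with
  | zero =>
    have : antitoneBox 0 N = {Fin.elim0} := by
      ext k
      simp [mem_antitoneBox, Antitone, Subsingleton.elim k Fin.elim0]
    simp [wedgeSum, this]
  | succ p ih =>
    simp only [wedgeSum, ih, mul_sum]
    rw [sum_sigma']
    refine sum_bij' (fun x _ => (Fin.cons x.1 x.2 : Fin (p + 1) → ℕ))
      (fun k _ => ⟨k 0, Fin.tail k⟩) ?_ ?_ ?_ ?_ ?_
    · rintro ⟨j, k⟩ h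
      simp only [mem_sigma, mem_Icc, mem_antitoneBox] at h
      rw [mem_antitoneBox, Fin.antitone_cons]
      refine ⟨fun i => ?_, fun i => (h.2.1 i).2, h.2.2⟩
      induction i using Fin.cases with
      | zero => simpa using h.1
      | succ i => simpa using ⟨(h.2.1 i).1, (h.2.1 i).2.trans h.1.2⟩
    · intro k h
      rw [← Fin.cons_self_tail k, mem_antitoneBox, Fin.antitone_cons] at h
      simp only [mem_sigma, mem_Icc, mem_antitoneBox]
      refine ⟨by simpa using h.1 0, fun i => ⟨by simpa using (h.1 i.succ).1, h.2.1 i⟩, h.2.2⟩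
    · rintro ⟨j, k⟩ h
      simp
    · intro k h
      simp
    · rintro ⟨j, k⟩ h
      rw [ιMulti_succ_apply]
      rfl

end WedgeSum

/-! ### Rational fractions with poles at the integers of `[-m, m]` -/

section RationalFractions

open Polynomial Finset Filter Topology

/-- The polynomial `∏ (X - j)` over the integers `-m ≤ j ≤ m`. -/
noncomputable def centralPoly (m : ℕ) : ℚ[X] :=
  ∏ j ∈ Icc (-m : ℤ) m, (X - C (j : ℚ))

theorem centralPoly_monic (m : ℕ) : (centralPoly m).Monic :=
  monic_prod_of_monic _ _ fun _ _ => monic_X_sub_C _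

theorem centralPoly_natDegree (m : ℕ) : (centralPoly m).natDegree = 2 * m + 1 := by
  rw [centralPoly, natDegree_prod_of_monic _ _ fun _ _ => monic_X_sub_C _]
  simp only [natDegree_X_sub_C, sum_const, Int.card_Icc, smul_eq_mul, mul_one]
  omega

theorem centralPoly_eval (m : ℕ) (x : ℚ) :
    (centralPoly m).eval x = ∏ j ∈ Icc (-m : ℤ) m, (x - j) := by
  simp [centralPoly, eval_prod]

theorem centralPoly_eval_ne_zero_iff {m : ℕ} {x : ℚ} :
    (centralPoly m).eval x ≠ 0 ↔ ∀ j ∈ Icc (-m : ℤ) m, x - j ≠ 0 := by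
  rw [centralPoly_eval, prod_ne_zero_iff]

theorem centralPoly_eval_neg (m : ℕ) (x : ℚ) :
    (centralPoly m).eval (-x) = -(centralPoly m).eval x := by
  have h : ∏ j ∈ Icc (-m : ℤ) m, (-x - j) = ∏ j ∈ Icc (-m : ℤ) m, (-1) * (x - j) := by
    refine prod_nbij' (fun j => -j) (fun j => -j) ?_ ?_ ?_ ?_ ?_
    all_goals simp only [mem_Icc]
    all_goals intro j _
    · omega
    · omega
    · ring
    · ring
    · push_cast; ring
  rw [centralPoly_eval, h, prod_mul_distrib, prod_const, centralPoly_eval,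
    Odd.neg_one_pow (by simp; exact ⟨m, by omega⟩), neg_one_mul]

theorem centralPoly_eval_ne_zero_of_lt {m : ℕ} {x : ℚ} (h : (m : ℚ) < x) :
    (centralPoly m).eval x ≠ 0 := by
  rw [centralPoly_eval_ne_zero_iff]
  intro j hj
  have : (j : ℚ) ≤ m := by exact_mod_cast (mem_Icc.1 hj).2
  linarith

/-- `f` agrees with `U / ∏_{|j| ≤ m} (x - j) ^ r` away from the poles, where
`deg U ≤ r (2 m + 1) - e`. -/
def IsFrac (m r e : ℕ) (f : ℚ → ℚ) : Prop :=
  ∃ U : ℚ[X], U.natDegree + e ≤ r * (2 * m + 1) ∧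
    ∀ x, (centralPoly m).eval x ≠ 0 → f x = U.eval x / (centralPoly m).eval x ^ r

namespace IsFrac

variable {m r s e d : ℕ} {f g : ℚ → ℚ}

theorem add (hf : IsFrac m r e f) (hg : IsFrac m r e g) :
    IsFrac m r e fun x => f x + g x := by
  obtain ⟨U, hU, hfU⟩ := hf
  obtain ⟨V, hV, hgV⟩ := hg
  refine ⟨U + V, ?_, fun x hx => ?_⟩
  · have := natDegree_add_le U V
    have := max_le_iff.2 ⟨hU, hV⟩
    omega
  · simp only [hfU x hx, hgV x hx, eval_add, add_div]

theorem const_mul (c : ℚ) (hf : IsFrac m r e f) : IsFrac m r e fun x => c * f x := by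
  obtain ⟨U, hU, hfU⟩ := hf
  refine ⟨C c * U, ?_, fun x hx => ?_⟩
  · have := natDegree_C_mul_le c U
    omega
  · simp only [hfU x hx, eval_mul, eval_C, mul_div_assoc]

theorem mul (hf : IsFrac m r e f) (hg : IsFrac m s d g) :
    IsFrac m (r + s) (e + d) fun x => f x * g x := by
  obtain ⟨U, hU, hfU⟩ := hf
  obtain ⟨V, hV, hgV⟩ := hg
  refine ⟨U * V, ?_, fun x hx => ?_⟩
  · have := natDegree_mul_le (p := U) (q := V)
    rw [add_mul]
    omega
  · simp only
    rw [hfU x hx, hgV x hx, eval_mul, pow_add, div_mul_div_comm]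

theorem zero (h : e ≤ r * (2 * m + 1)) : IsFrac m r e fun _ => 0 :=
  ⟨0, by simpa using h, fun x _ => by simp⟩

theorem sum {ι : Type*} {S : Finset ι} {F : ι → ℚ → ℚ} (h : e ≤ r * (2 * m + 1))
    (hF : ∀ i ∈ S, IsFrac m r e (F i)) : IsFrac m r e fun x => ∑ i ∈ S, F i x := by
  classical
  induction S using Finset.induction_on with
  | empty => simpa using zero h
  | insert a S ha ih =>
    simp only [sum_insert ha]
    exact (hF a (mem_insert_self _ _)).add (ih fun i hi => hF i (mem_insert_of_mem hi))

theorem one_div_pow {j : ℤ} (hj : j ∈ Icc (-m : ℤ) m) (hs : 1 ≤ s) (hsr : s ≤ r) :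
    IsFrac m r 1 fun x => 1 / (x - j) ^ s := by
  set E : ℚ[X] := ∏ i ∈ (Icc (-m : ℤ) m).erase j, (X - C (i : ℚ)) with hE
  have hEΔ : (X - C (j : ℚ)) * E = centralPoly m :=
    mul_prod_erase (Icc (-m : ℤ) m) (fun i : ℤ => X - C (i : ℚ)) hj
  have hEm : E.Monic := monic_prod_of_monic _ _ fun _ _ => monic_X_sub_C _
  have hEd : E.natDegree = 2 * m := by
    rw [hE, natDegree_prod_of_monic _ _ fun _ _ => monic_X_sub_C _]
    simp only [natDegree_X_sub_C, sum_const, card_erase_of_mem hj, Int.card_Icc, smul_eq_mul,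
      mul_one]
    omega
  clear_value E
  -- Numerator and denominator are multiplied by the factors missing from `(x - j) ^ s`; the degree
  -- drops by `s ≥ 1`.
  refine ⟨E ^ s * centralPoly m ^ (r - s), ?_, fun x hx => ?_⟩
  · rw [(hEm.pow s).natDegree_mul ((centralPoly_monic m).pow _), hEm.natDegree_pow,
      (centralPoly_monic m).natDegree_pow, hEd, centralPoly_natDegree]
    obtain ⟨t, rfl⟩ := Nat.exists_eq_add_of_le hsr
    rw [Nat.add_sub_cancel_left]
    nlinarith
  · have h1 : x - j ≠ 0 := centralPoly_eval_ne_zero_iff.1 hx j hj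
    have h2 : (x - j) * E.eval x = (centralPoly m).eval x := by rw [← hEΔ]; simp
    have h3 : E.eval x ≠ 0 := by
      rintro h
      rw [h, mul_zero] at h2
      exact hx h2.symm
    rw [eval_mul, eval_pow, eval_pow]
    conv_rhs => rw [← Nat.add_sub_cancel' hsr, pow_add, Nat.add_sub_cancel_left]
    rw [mul_div_mul_right _ _ (pow_ne_zero _ hx), ← h2, mul_pow]
    field_simp

theorem tendsto_zero (hf : IsFrac m r 1 f) : Tendsto f atTop (𝓝 0) := by
  obtain ⟨U, hU, hfU⟩ := hf
  have h : Tendsto (fun x => U.eval x / (centralPoly m ^ r).eval x) atTop (𝓝 0) := by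
    refine div_tendsto_atTop_zero_of_degree_lt _ _ (degree_lt_degree ?_)
    rw [(centralPoly_monic m).natDegree_pow, centralPoly_natDegree]
    omega
  refine h.congr' ?_
  filter_upwards [eventually_gt_atTop (m : ℚ)] with x hx
  rw [hfU x (centralPoly_eval_ne_zero_of_lt hx), eval_pow]

theorem tendsto_mul_self_zero (hf : IsFrac m r 2 f) : Tendsto (fun x => x * f x) atTop (𝓝 0) := by
  obtain ⟨U, hU, hfU⟩ := hf
  have h : Tendsto (fun x => (X * U).eval x / (centralPoly m ^ r).eval x) atTop (𝓝 0) := by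
    refine div_tendsto_atTop_zero_of_degree_lt _ _ (degree_lt_degree ?_)
    rw [(centralPoly_monic m).natDegree_pow, centralPoly_natDegree]
    have := natDegree_mul_le (p := X) (q := U)
    rw [natDegree_X] at this
    omega
  refine h.congr' ?_
  filter_upwards [eventually_gt_atTop (m : ℚ)] with x hx
  rw [hfU x (centralPoly_eval_ne_zero_of_lt hx), eval_pow, eval_mul, eval_X, mul_div_assoc]

theorem weaken (h : IsFrac m r 2 f) : IsFrac m r 1 f := by
  obtain ⟨U, hU, hfU⟩ := h
  exact ⟨U, by omega, hfU⟩

theorem mono (h : IsFrac m r e f) (hrs : r ≤ s) : IsFrac m s e f := by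
  obtain ⟨U, hU, hfU⟩ := h
  obtain ⟨t, rfl⟩ := Nat.exists_eq_add_of_le hrs
  refine ⟨U * centralPoly m ^ t, ?_, fun x hx => ?_⟩
  · have := natDegree_mul_le (p := U) (q := centralPoly m ^ t)
    rw [(centralPoly_monic m).natDegree_pow, centralPoly_natDegree] at this
    rw [add_mul]
    omega
  · rw [hfU x hx, eval_mul, eval_pow, pow_add, mul_div_mul_right _ _ (pow_ne_zero _ hx)]

/-- Partial fraction decomposition. -/
theorem exists_eq_sum (hf : IsFrac m r 1 f) :
    ∃ c : ℕ → ℤ → ℚ, ∀ x, (centralPoly m).eval x ≠ 0 →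
      f x = ∑ s ∈ range r, ∑ j ∈ Icc (-m : ℤ) m, c s j * (1 / (x - j) ^ (s + 1)) := by
  obtain ⟨U, hU, hfU⟩ := id hf
  obtain ⟨q, R, hR, hUR⟩ := eq_quo_mul_prod_pow_add_sum_rem_mul_prod_pow
    (s := Icc (-m : ℤ) m) U (g := fun j : ℤ => X - C (j : ℚ)) (fun _ _ => monic_X_sub_C _)
    (fun i _ j _ hij => isCoprime_X_sub_C_of_isUnit_sub
      (sub_ne_zero.2 (by exact_mod_cast hij)).isUnit) (fun _ => r)
  -- `R j i` multiplies `(x - j) ^ i / (x - j) ^ r`, so the pole of order `s + 1` has `i = r - 1 -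
  -- s`. The default `0` occurs only for `r = 0`, where the sum is empty.
  set c : ℕ → ℤ → ℚ := fun s j => if h : r - 1 - s < r then (R j ⟨r - 1 - s, h⟩).coeff 0 else 0
    with hc
  have key : ∀ x, (centralPoly m).eval x ≠ 0 → f x = q.eval x +
      ∑ s ∈ range r, ∑ j ∈ Icc (-m : ℤ) m, c s j * (1 / (x - j) ^ (s + 1)) := by
    intro x hx
    have hx' := centralPoly_eval_ne_zero_iff.1 hx
    rw [hfU x hx, div_eq_iff (pow_ne_zero _ hx), add_mul, sum_comm (s := range r), hUR, sum_mul]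
    simp only [eval_add, eval_mul, eval_prod, eval_finsetSum, eval_pow, eval_sub, eval_X, eval_C]
    rw [centralPoly_eval, ← prod_pow]
    refine congrArg₂ (· + ·) rfl (sum_congr rfl fun j hj => ?_)
    rw [sum_mul, ← Fin.sum_univ_eq_sum_range
      (fun i => c i j * (1 / (x - j) ^ (i + 1)) * ∏ j ∈ Icc (-m : ℤ) m, (x - j) ^ r) r]
    refine Fintype.sum_equiv Fin.revPerm _ _ fun i => ?_
    have h1 : c (Fin.revPerm i) j = (R j i).coeff 0 := by
      have : r - 1 - (Fin.revPerm i : ℕ) = i := by simp [Fin.val_rev]; omega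
      simp only [hc, this, Fin.is_lt, dite_true]
    have h2 : (R j i).eval x = (R j i).coeff 0 := by
      have h := hR j hj i
      rw [degree_X_sub_C, ← Nat.cast_one, degree_lt_iff_coeff_zero] at h
      rw [eq_C_of_natDegree_eq_zero (p := R j i) (by
        by_contra hne
        exact (leadingCoeff_ne_zero.2 (by rintro h0; simp [h0] at hne))
          (h _ (by omega)))]
      simp
    rw [h1, h2, ← mul_prod_erase _ _ hj]
    have h3 : (x - (j : ℚ)) ^ r = (x - j) ^ (i : ℕ) * (x - j) ^ ((Fin.revPerm i : ℕ) + 1) := by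
      rw [← pow_add]
      congr 1
      simp [Fin.val_rev]
      omega
    have := hx' j hj
    rw [h3]
    field_simp
  -- The polynomial part tends to zero at infinity, hence vanishes.
  have hq : q = 0 := by
    have h0 : Tendsto (fun x : ℚ => ∑ s ∈ range r, ∑ j ∈ Icc (-m : ℤ) m,
        c s j * (1 / (x - j) ^ (s + 1))) atTop (𝓝 0) := by
      refine (IsFrac.sum (m := m) (r := r) (e := 1) (by omega) fun s hs =>
        IsFrac.sum (by omega) fun j hj =>
        (one_div_pow hj (by omega) (by have := mem_range.1 hs; omega)).const_mul _).tendsto_zero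
    have h1 : Tendsto (fun x => q.eval x) atTop (𝓝 0) := by
      have := hf.tendsto_zero.sub h0
      rw [sub_zero] at this
      refine this.congr' ?_
      filter_upwards [eventually_gt_atTop (m : ℚ)] with x hx
      rw [key x (centralPoly_eval_ne_zero_of_lt hx)]
      ring
    exact leadingCoeff_eq_zero.1 ((tendsto_nhds_iff q).1 h1).1
  exact ⟨c, fun x hx => by rw [key x hx, hq]; simp⟩

end IsFrac

end RationalFractions

/-! ### Sequences with limit in `ℚ[ζ(3)]` -/

section ZetaSequences

open Polynomial Finset Filter Topology

/-- The rational sequences which converge to an element of `ℚ[ζ(3)]`. -/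
noncomputable def zetaSeq : Subalgebra ℚ (ℕ → ℚ) where
  carrier := {u | ∃ z ∈ Algebra.adjoin ℚ {riemannZeta 3},
    Tendsto (fun N => (u N : ℂ)) atTop (𝓝 z)}
  mul_mem' := by
    rintro u v ⟨y, hy, hu⟩ ⟨z, hz, hv⟩
    exact ⟨y * z, mul_mem hy hz, by simpa using hu.mul hv⟩
  add_mem' := by
    rintro u v ⟨y, hy, hu⟩ ⟨z, hz, hv⟩
    exact ⟨y + z, add_mem hy hz, by simpa using hu.add hv⟩
  algebraMap_mem' c := ⟨c, by
    simpa using (Algebra.adjoin ℚ {riemannZeta 3}).algebraMap_mem c, by simp⟩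

theorem mem_zetaSeq_of_tendsto {u : ℕ → ℚ} {q : ℚ} (h : Tendsto u atTop (𝓝 q)) :
    u ∈ zetaSeq := by
  refine ⟨q, by simpa using (Algebra.adjoin ℚ {riemannZeta 3}).algebraMap_mem q, ?_⟩
  have h1 : Continuous fun q : ℚ => (q : ℂ) := by
    have : (fun q : ℚ => (q : ℂ)) = fun q : ℚ => ((q : ℝ) : ℂ) := by ext; simp
    rw [this]
    exact Complex.continuous_ofReal.comp Rat.continuous_coe_real
  exact (h1.tendsto q).comp h

theorem const_mem_zetaSeq (q : ℚ) : (fun _ => q) ∈ zetaSeq :=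
  mem_zetaSeq_of_tendsto tendsto_const_nhds

theorem sum_one_div_cube_mem_zetaSeq (m : ℕ) :
    (fun N : ℕ => ∑ k ∈ Icc 1 N, 1 / ((k + m : ℕ) : ℚ) ^ 3) ∈ zetaSeq := by
  -- The term `k = 0` is `1 / 0 = 0`, so these are partial sums of `ζ(3)`.
  have h : (fun N : ℕ => ∑ k ∈ range (N + m + 1), 1 / (k : ℚ) ^ 3) ∈ zetaSeq := by
    refine ⟨riemannZeta 3, Algebra.subset_adjoin rfl, ?_⟩
    have h1 : Summable fun n : ℕ => 1 / (n : ℂ) ^ 3 := by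
      have := (Real.summable_one_div_nat_pow (p := 3)).2 (by norm_num)
      exact (Complex.ofRealCLM.summable this).congr fun n => by simp
    have h2 := h1.hasSum.tendsto_sum_nat
    have h3 := zeta_nat_eq_tsum_of_gt_one (k := 3) (by norm_num)
    rw [← h3] at h2
    have h4 := h2.comp (tendsto_add_atTop_nat (m + 1))
    refine Tendsto.congr (fun N => ?_) (by exact_mod_cast h4)
    simp [add_assoc]
  have h' := sub_mem h (const_mem_zetaSeq (∑ k ∈ range (m + 1), 1 / (k : ℚ) ^ 3))
  refine cast (congrArg (· ∈ zetaSeq) (funext fun N => ?_)) h'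
  simp only [Pi.sub_apply]
  induction N with
  | zero => simp
  | succ N ih =>
    rw [sum_Icc_succ_top (by omega), ← ih, show N + 1 + m + 1 = (N + m + 1) + 1 by ring,
      sum_range_succ _ (N + m + 1)]
    push_cast
    ring

end ZetaSequences

/-! ### Symmetric primitives, and sums of depth one and two -/

section Primitives

open Polynomial Finset Filter Topology

/-- `f` is a difference `F (x - 1) - F x`, where `F` is a rational fraction which is invariant
under `x ↦ - 1 - x` and vanishes at infinity. -/
def HasPrimitive (m r : ℕ) (f : ℚ → ℚ) : Prop :=
  ∃ F : ℚ → ℚ, (∀ x, (centralPoly m).eval x ≠ 0 → F (x - 1) - F x = f x) ∧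
    (∀ x, F (-1 - x) = F x) ∧ IsFrac m r 1 F ∧ IsFrac m r 1 fun x => F (x - 1)

namespace HasPrimitive

variable {m r : ℕ} {f g : ℚ → ℚ}

theorem add (hf : HasPrimitive m r f) (hg : HasPrimitive m r g) :
    HasPrimitive m r fun x => f x + g x := by
  obtain ⟨F, h1, h2, h3, h4⟩ := hf
  obtain ⟨G, k1, k2, k3, k4⟩ := hg
  refine ⟨fun x => F x + G x, fun x hx => ?_, fun x => ?_, h3.add k3, h4.add k4⟩
  · simp only [← h1 x hx, ← k1 x hx]
    ring
  · simp only [h2, k2]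

theorem const_mul (c : ℚ) (hf : HasPrimitive m r f) : HasPrimitive m r fun x => c * f x := by
  obtain ⟨F, h1, h2, h3, h4⟩ := hf
  refine ⟨fun x => c * F x, fun x hx => ?_, fun x => ?_, h3.const_mul c, h4.const_mul c⟩
  · simp only [← h1 x hx]
    ring
  · simp only [h2]

theorem zero (hr : 1 ≤ r) : HasPrimitive m r fun _ => 0 := by
  have : 1 ≤ r * (2 * m + 1) := Nat.one_le_iff_ne_zero.2 (by positivity)
  exact ⟨fun _ => 0, by simp, by simp, IsFrac.zero this, IsFrac.zero this⟩

theorem sum {ι : Type*} {S : Finset ι} {f : ι → ℚ → ℚ} (hr : 1 ≤ r)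
    (hf : ∀ i ∈ S, HasPrimitive m r (f i)) : HasPrimitive m r fun x => ∑ i ∈ S, f i x := by
  classical
  induction S using Finset.induction_on with
  | empty => simpa using zero hr
  | insert a S ha ih =>
    simp only [sum_insert ha]
    exact (hf a (mem_insert_self _ _)).add (ih fun i hi => hf i (mem_insert_of_mem hi))

theorem congr (hf : HasPrimitive m r f) (h : ∀ x, (centralPoly m).eval x ≠ 0 → g x = f x) :
    HasPrimitive m r g := by
  obtain ⟨F, h1, h2⟩ := hf
  exact ⟨F, fun x hx => by rw [h1 x hx, h x hx], h2⟩

theorem sum_mem_zetaSeq (hf : HasPrimitive m r f) :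
    (fun N : ℕ => ∑ k ∈ Icc 1 N, f ((k + m : ℕ) : ℚ)) ∈ zetaSeq := by
  obtain ⟨F, h1, -, h3, -⟩ := hf
  have h : ∀ N : ℕ, ∑ k ∈ Icc 1 N, f ((k + m : ℕ) : ℚ) = F m - F ((N + m : ℕ) : ℚ) := by
    intro N
    induction N with
    | zero => simp
    | succ N ih =>
      rw [sum_Icc_succ_top (by omega), ih,
        ← h1 _ (centralPoly_eval_ne_zero_of_lt (by exact_mod_cast (by omega)))]
      have : ((N + 1 + m : ℕ) : ℚ) - 1 = ((N + m : ℕ) : ℚ) := by push_cast; ring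
      rw [this]
      ring
  simp only [h]
  have := (h3.tendsto_zero.comp tendsto_natCast_atTop_atTop).comp (tendsto_add_atTop_nat m)
  exact mem_zetaSeq_of_tendsto (tendsto_const_nhds.sub this)

end HasPrimitive

/-- The odd part of `1 / (x - j) ^ s - 1 / x ^ s`, times two. -/
def oddPole (s : ℕ) (j : ℤ) (x : ℚ) : ℚ :=
  1 / (x - j) ^ s - (-1) ^ s / (x + j) ^ s - (1 - (-1) ^ s) / x ^ s

theorem one_div_neg_pow (y : ℚ) (s : ℕ) : 1 / (-y) ^ s = (-1) ^ s / y ^ s := by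
  rw [← neg_one_mul y, mul_pow, one_div, mul_inv, ← inv_pow, div_eq_mul_inv]
  norm_num

theorem oddPole_neg (s : ℕ) (j : ℤ) (x : ℚ) :
    oddPole s (-j) x = -(-1) ^ s * oddPole s j x := by
  have h : ((-1 : ℚ) ^ s) * (-1) ^ s = 1 := by rw [← mul_pow]; simp
  unfold oddPole
  push_cast
  rw [sub_neg_eq_add, ← sub_eq_add_neg]
  linear_combination (1 / x ^ s - 1 / (x + j) ^ s) * h

/-- The poles `j` and `-j` are moved to `0` by unit steps, each of which is a difference. The
primitive has poles paired as `i` and `-(i + 1)`, which `x ↦ -1 - x` exchanges. Since `i < j ≤ m`,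
the poles of both `F x` and `F (x - 1)` stay in `[-m, m]`. -/
theorem oddPole_hasPrimitive_natCast {m r s j : ℕ} (hs : 1 ≤ s) (hsr : s ≤ r) (hj : j ≤ m) :
    HasPrimitive m r (oddPole s j) := by
  have hpos : 1 ≤ r * (2 * m + 1) := Nat.one_le_iff_ne_zero.2 (by
    have : 1 ≤ r := hs.trans hsr
    positivity)
  have hpole : ∀ i : ℤ, -m ≤ i → i ≤ m → IsFrac m r 1 fun x => 1 / (x - i) ^ s :=
    fun i h1 h2 => IsFrac.one_div_pow (mem_Icc.2 ⟨h1, h2⟩) hs hsr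
  refine ⟨fun x => ∑ i ∈ range j, (1 / (x - (i : ℤ)) ^ s +
    (-1) ^ s * (1 / (x - (-(i + 1) : ℤ)) ^ s)), fun x _ => ?_, fun x => ?_, ?_, ?_⟩
  · clear hj
    simp only
    induction j with
    | zero => simp [oddPole]; ring
    | succ j ih =>
      rw [sum_range_succ, sum_range_succ]
      have : oddPole s (j + 1 : ℕ) x = oddPole s j x + (1 / (x - (j + 1)) ^ s - 1 / (x - j) ^ s)
          - (-1) ^ s * (1 / (x + (j + 1)) ^ s - 1 / (x + j) ^ s) := by
        unfold oddPole
        push_cast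
        ring
      rw [this, ← ih]
      push_cast
      ring_nf
  · refine sum_congr rfl fun i _ => ?_
    have h : ((-1 : ℚ) ^ s) * (-1) ^ s = 1 := by rw [← mul_pow]; simp
    push_cast
    rw [show -1 - x - (i : ℚ) = -(x - -(i + 1)) by ring,
      show -1 - x - -((i : ℚ) + 1) = -(x - i) by ring, one_div_neg_pow, one_div_neg_pow]
    linear_combination (1 / (x - i) ^ s) * h
  · refine IsFrac.sum hpos fun i hi => ?_
    have := mem_range.1 hi
    exact (hpole _ (by omega) (by omega)).add ((hpole _ (by omega) (by omega)).const_mul _)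
  · refine IsFrac.sum hpos fun i hi => ?_
    have := mem_range.1 hi
    have h := (hpole (i + 1) (by omega) (by omega)).add
      ((hpole (-i) (by omega) (by omega)).const_mul ((-1) ^ s))
    refine cast (congrArg _ (funext fun x => ?_)) h
    push_cast
    ring_nf

theorem oddPole_hasPrimitive {m r s : ℕ} {j : ℤ} (hs : 1 ≤ s) (hsr : s ≤ r)
    (hj : j ∈ Icc (-m : ℤ) m) : HasPrimitive m r (oddPole s j) := by
  have hj' := mem_Icc.1 hj
  rcases Int.natAbs_eq j with h | h
  · rw [h]
    exact oddPole_hasPrimitive_natCast hs hsr (by omega)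
  · rw [h, funext (oddPole_neg s _)]
    exact (oddPole_hasPrimitive_natCast hs hsr (by omega)).const_mul _

/-- Partial fraction decomposition of an odd fraction. -/
theorem IsFrac.exists_eq_sum_oddPole {m r : ℕ} {f : ℚ → ℚ} (hf : IsFrac m r 2 f)
    (hodd : ∀ x, (centralPoly m).eval x ≠ 0 → f (-x) = -f x) :
    ∃ (g : ℚ → ℚ) (c : ℕ → ℚ), HasPrimitive m r g ∧ c 0 = 0 ∧
      ∀ x, (centralPoly m).eval x ≠ 0 →
        f x = g x + ∑ s ∈ range r, c s * ((1 - (-1) ^ (s + 1)) / x ^ (s + 1)) := by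
  rcases Nat.eq_zero_or_pos r with rfl | hr
  · obtain ⟨U, hU, -⟩ := hf
    omega
  obtain ⟨c, hc⟩ := hf.weaken.exists_eq_sum
  refine ⟨fun x => ∑ s ∈ range r, ∑ j ∈ Icc (-m : ℤ) m, c s j / 2 * oddPole (s + 1) j x,
    fun s => ∑ j ∈ Icc (-m : ℤ) m, c s j / 2, ?_, ?_, ?_⟩
  · refine HasPrimitive.sum hr fun s hs => HasPrimitive.sum hr fun j hj => ?_
    exact (oddPole_hasPrimitive (by omega) (by have := mem_range.1 hs; omega) hj).const_mul _
  · have h1 : Tendsto (fun x : ℚ => ∑ s ∈ range r, ∑ j ∈ Icc (-m : ℤ) m,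
        c s j * (x * (1 / (x - j) ^ (s + 1)))) atTop
        (𝓝 (∑ s ∈ range r, ∑ j ∈ Icc (-m : ℤ) m, c s j * if s = 0 then 1 else 0)) := by
      refine tendsto_finsetSum _ fun s _ => tendsto_finsetSum _ fun j _ =>
        Tendsto.const_mul _ ?_
      have h0 : Tendsto (fun x : ℚ => x - j) atTop atTop := by
        simpa [sub_eq_add_neg] using tendsto_atTop_add_const_right atTop (-(j : ℚ)) tendsto_id
      have hinv : Tendsto (fun x : ℚ => 1 / (x - j)) atTop (𝓝 0) := by
        simp only [one_div]
        exact tendsto_inv_atTop_zero.comp h0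
      have h2 : Tendsto (fun x : ℚ => x * (1 / (x - j))) atTop (𝓝 1) := by
        have : Tendsto (fun x : ℚ => 1 + j * (1 / (x - j))) atTop (𝓝 (1 + j * 0)) :=
          tendsto_const_nhds.add (hinv.const_mul _)
        rw [mul_zero, add_zero] at this
        refine this.congr' ?_
        filter_upwards [eventually_gt_atTop (j : ℚ)] with x hx
        have : x - j ≠ 0 := by linarith
        field_simp
        ring
      split_ifs with h
      · subst h
        simpa using h2
      · have := h2.mul (hinv.pow s)
        rw [zero_pow h, mul_zero] at this
        refine this.congr fun x => ?_
        rw [pow_succ', _root_.one_div_pow, ← one_div_mul_one_div]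
        ring
    have h2 := hf.tendsto_mul_self_zero
    have h3 : Tendsto (fun x : ℚ => x * f x) atTop
        (𝓝 (∑ s ∈ range r, ∑ j ∈ Icc (-m : ℤ) m, c s j * if s = 0 then 1 else 0)) := by
      refine h1.congr' ?_
      filter_upwards [eventually_gt_atTop (m : ℚ)] with x hx
      rw [hc x (centralPoly_eval_ne_zero_of_lt hx), mul_sum]
      refine sum_congr rfl fun s _ => ?_
      rw [mul_sum]
      exact sum_congr rfl fun j _ => by ring
    have h4 := tendsto_nhds_unique h3 h2
    simp only [mul_ite, mul_one, mul_zero] at h4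
    rw [sum_eq_single_of_mem 0 (mem_range.2 hr) (by
      intro s _ hs
      simp [hs])] at h4
    simp only [if_true] at h4
    simp only [← sum_div, h4, zero_div]
  · intro x hx
    have hx' : (centralPoly m).eval (-x) ≠ 0 := by
      rw [centralPoly_eval_neg]
      exact neg_ne_zero.2 hx
    have h1 : f x = (f x - f (-x)) / 2 := by rw [hodd x hx]; ring
    rw [h1, hc x hx, hc _ hx', ← sum_sub_distrib, sum_div, ← sum_add_distrib]
    refine sum_congr rfl fun s _ => ?_
    rw [← sum_sub_distrib, sum_div, sum_mul, ← sum_add_distrib]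
    refine sum_congr rfl fun j _ => ?_
    rw [show -x - (j : ℚ) = -(x + j) by ring, one_div_neg_pow, oddPole]
    ring

/-- Of the terms left at `0`, the simple pole has coefficient zero by the residue sum, and the
double pole has the factor `1 - (-1) ^ 2 = 0`. -/
theorem IsFrac.hasPrimitive_of_odd {m : ℕ} {f : ℚ → ℚ} (hf : IsFrac m 2 2 f)
    (hodd : ∀ x, (centralPoly m).eval x ≠ 0 → f (-x) = -f x) : HasPrimitive m 2 f := by
  obtain ⟨g, c, hg, hc, h⟩ := hf.exists_eq_sum_oddPole hodd
  refine hg.congr fun x hx => ?_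
  rw [h x hx]
  simp [sum_range_succ, hc]

/-- Among the orders one to four, parity and the residue sum leave only `1 / x ^ 3`. -/
theorem IsFrac.sum_mem_zetaSeq_of_odd {m : ℕ} {f : ℚ → ℚ} (hf : IsFrac m 4 2 f)
    (hodd : ∀ x, (centralPoly m).eval x ≠ 0 → f (-x) = -f x) :
    (fun N : ℕ => ∑ k ∈ Icc 1 N, f ((k + m : ℕ) : ℚ)) ∈ zetaSeq := by
  obtain ⟨g, c, hg, hc, h⟩ := hf.exists_eq_sum_oddPole hodd
  have h1 := add_mem hg.sum_mem_zetaSeq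
    (mul_mem (const_mem_zetaSeq (2 * c 2)) (sum_one_div_cube_mem_zetaSeq m))
  refine cast (congrArg (· ∈ zetaSeq) (funext fun N => ?_)) h1
  simp only [Pi.add_apply, Pi.mul_apply]
  rw [mul_sum, ← sum_add_distrib]
  refine sum_congr rfl fun k hk => ?_
  have := (mem_Icc.1 hk).1
  rw [h _ (centralPoly_eval_ne_zero_of_lt (by exact_mod_cast (by omega)))]
  simp [sum_range_succ, hc]
  ring

/-- The inner sums telescope to `G m - G x` and `F m - F x`, with `x = k + m`. The constants `F m`
and `G m` contribute boundary terms, and the rest is `w x`. The reflection `x ↦ -x` exchanges the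
values at `x` and `x - 1` of a symmetric primitive, so `w` is odd. -/
theorem HasPrimitive.antisymm_pair_sum_mem_zetaSeq {m : ℕ} {f g : ℚ → ℚ}
    (hf : HasPrimitive m 2 f) (hg : HasPrimitive m 2 g) :
    (fun N : ℕ => ∑ k ∈ Icc 1 N, ∑ l ∈ Icc 1 k, (f ((k + m : ℕ) : ℚ) * g ((l + m : ℕ) : ℚ) -
      g ((k + m : ℕ) : ℚ) * f ((l + m : ℕ) : ℚ))) ∈ zetaSeq := by
  obtain ⟨F, hF1, hF2, hF3, hF4⟩ := hf
  obtain ⟨G, hG1, hG2, hG3, hG4⟩ := hg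
  set w : ℚ → ℚ := fun x => F x * G (x - 1) + -1 * (F (x - 1) * G x) with hw
  have hwf : IsFrac m 4 2 w := (hF3.mul hG4).add ((hF4.mul hG3).const_mul (-1))
  have hwodd : ∀ x, w (-x) = -w x := by
    intro x
    have h1 : ∀ {H : ℚ → ℚ}, (∀ x, H (-1 - x) = H x) → H (-x) = H (x - 1) := by
      intro H hH
      rw [← hH]; congr 1; ring
    have h2 : ∀ {H : ℚ → ℚ}, (∀ x, H (-1 - x) = H x) → H (-x - 1) = H x := by
      intro H hH
      rw [← hH]; congr 1; ring
    simp only [hw, h1 hF2, h1 hG2, h2 hF2, h2 hG2]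
    ring
  have hsum := hwf.sum_mem_zetaSeq_of_odd fun x _ => hwodd x
  have htend : ∀ {H : ℚ → ℚ}, IsFrac m 2 1 H →
      (fun N : ℕ => H ((N + m : ℕ) : ℚ)) ∈ zetaSeq := fun hH =>
    mem_zetaSeq_of_tendsto
      ((hH.tendsto_zero.comp tendsto_natCast_atTop_atTop).comp (tendsto_add_atTop_nat m))
  have h := sub_mem (add_mem hsum (mul_mem (const_mem_zetaSeq (F m)) (htend hG3)))
    (mul_mem (const_mem_zetaSeq (G m)) (htend hF3))
  refine cast (congrArg (· ∈ zetaSeq) (funext fun N => ?_)) h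
  have hstep : ∀ N : ℕ, F (((N + 1 + m : ℕ) : ℚ) - 1) = F ((N + m : ℕ) : ℚ) ∧
      G (((N + 1 + m : ℕ) : ℚ) - 1) = G ((N + m : ℕ) : ℚ) := by
    intro N
    constructor <;> · congr 1; push_cast; ring
  have hne : ∀ N : ℕ, (centralPoly m).eval ((N + 1 + m : ℕ) : ℚ) ≠ 0 := fun N =>
    centralPoly_eval_ne_zero_of_lt (by exact_mod_cast (by omega))
  have hsingle : ∀ N : ℕ, ∑ l ∈ Icc 1 N, f ((l + m : ℕ) : ℚ) = F m - F ((N + m : ℕ) : ℚ) ∧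
      ∑ l ∈ Icc 1 N, g ((l + m : ℕ) : ℚ) = G m - G ((N + m : ℕ) : ℚ) := by
    intro N
    induction N with
    | zero => simp
    | succ N ih =>
      rw [sum_Icc_succ_top (by omega), sum_Icc_succ_top (by omega), ih.1, ih.2, ← hF1 _ (hne N),
        ← hG1 _ (hne N), (hstep N).1, (hstep N).2]
      constructor <;> ring
  simp only [sum_sub_distrib, ← mul_sum, (hsingle _).1, (hsingle _).2]
  simp only [Pi.add_apply, Pi.sub_apply, Pi.mul_apply, ← sum_sub_distrib]
  induction N with
  | zero => simp; ring
  | succ N ih =>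
    rw [sum_Icc_succ_top (by omega), sum_Icc_succ_top (by omega), ← ih, ← hF1 _ (hne N),
      ← hG1 _ (hne N), (hstep N).1, (hstep N).2]
    simp only [hw, (hstep N).1, (hstep N).2]
    ring

end Primitives

/-! ### From coordinate sums to alternating forms -/

section WedgeSumLimit

open ExteriorAlgebra Finset Filter Topology

variable {ι' : Type*} [Fintype ι'] [DecidableEq ι']

theorem ExteriorAlgebra.ι_eq_sum_single (x : ι' → ℚ) :
    ι ℚ x = ∑ a, x a • ι ℚ (Pi.single a (1 : ℚ) : ι' → ℚ) := by
  simp only [← map_smul, ← map_sum]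
  congr 1
  ext b
  simp [Finset.sum_apply, Pi.single_apply]

/-- The coefficients are antisymmetrized because only antisymmetrized double sums are known to have
limits in `ℚ[ζ(3)]`. -/
theorem ExteriorAlgebra.ι_mul_ι_eq_sum (x y : ι' → ℚ) :
    ι ℚ x * ι ℚ y = ∑ a, ∑ b, (1 / 2 * (x a * y b - x b * y a)) •
      (ι ℚ (Pi.single a (1 : ℚ) : ι' → ℚ) * ι ℚ (Pi.single b (1 : ℚ) : ι' → ℚ)) := by
  have h : ∀ x y : ι' → ℚ, ι ℚ x * ι ℚ y = ∑ a, ∑ b, (x a * y b) •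
      (ι ℚ (Pi.single a (1 : ℚ) : ι' → ℚ) * ι ℚ (Pi.single b (1 : ℚ) : ι' → ℚ)) := by
    intro x y
    rw [ι_eq_sum_single x, ι_eq_sum_single y, sum_mul_sum]
    simp only [smul_mul_smul_comm]
  have h2 : ι ℚ x * ι ℚ y = (1 / 2 : ℚ) • (ι ℚ x * ι ℚ y - ι ℚ y * ι ℚ x) := by
    rw [ι_mul_ι_comm y x, sub_neg_eq_add, ← two_smul ℚ, smul_smul]
    norm_num
  rw [h2, h x y, h y x, ← sum_sub_distrib, smul_sum]
  refine sum_congr rfl fun a _ => ?_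
  rw [← sum_sub_distrib, smul_sum]
  refine sum_congr rfl fun b _ => ?_
  rw [← sub_smul, smul_smul]
  ring_nf

variable {v : ℕ → ι' → ℚ}

/-- All functionals `Φ` are treated at once: in the induction, multiplication by a product of two
basis vectors is absorbed into `Φ`. -/
theorem linearMap_wedgePairSum_pow_mem_zetaSeq
    (hpair : ∀ a b, (fun N : ℕ => ∑ k ∈ Icc 1 N, ∑ l ∈ Icc 1 k,
      (v k a * v l b - v k b * v l a)) ∈ zetaSeq)
    (q : ℕ) (Φ : ExteriorAlgebra ℚ (ι' → ℚ) →ₗ[ℚ] ℚ) :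
    (fun N => Φ (wedgePairSum v N ^ q)) ∈ zetaSeq := by
  induction q generalizing Φ with
  | zero => simpa using const_mem_zetaSeq _
  | succ q ih =>
    have h1 : ∀ N, wedgePairSum v N = ∑ a, ∑ b, (1 / 2 * ∑ k ∈ Icc 1 N, ∑ l ∈ Icc 1 k,
        (v k a * v l b - v k b * v l a)) •
        (ι ℚ (Pi.single a (1 : ℚ) : ι' → ℚ) * ι ℚ (Pi.single b (1 : ℚ) : ι' → ℚ)) := by
      intro N
      have h : wedgePairSum v N = ∑ k ∈ Icc 1 N, ∑ l ∈ Icc 1 k, ∑ a, ∑ b,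
          (1 / 2 * (v k a * v l b - v k b * v l a)) •
          (ι ℚ (Pi.single a (1 : ℚ) : ι' → ℚ) * ι ℚ (Pi.single b (1 : ℚ) : ι' → ℚ)) :=
        sum_congr rfl fun k _ => by
          rw [map_sum, mul_sum]
          exact sum_congr rfl fun l _ => ι_mul_ι_eq_sum _ _
      rw [h]
      simp only [mul_sum, sum_smul]
      rw [sum_congr rfl fun k _ => sum_comm, sum_comm]
      refine sum_congr rfl fun a _ => ?_
      rw [sum_congr rfl fun k _ => sum_comm, sum_comm]
    have h2 : (fun N => Φ (wedgePairSum v N ^ (q + 1))) = ∑ a, ∑ b,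
        (fun _ => 1 / 2) * (fun N : ℕ => ∑ k ∈ Icc 1 N, ∑ l ∈ Icc 1 k,
        (v k a * v l b - v k b * v l a)) * (fun N => (Φ ∘ₗ LinearMap.mulLeft ℚ
        (ι ℚ (Pi.single a (1 : ℚ) : ι' → ℚ) * ι ℚ (Pi.single b (1 : ℚ) : ι' → ℚ)))
          (wedgePairSum v N ^ q)) := by
      funext N
      rw [pow_succ']
      simp only [Finset.sum_apply, Pi.mul_apply]
      generalize wedgePairSum v N ^ q = y
      rw [h1 N]
      simp only [sum_mul, map_sum, smul_mul_assoc, map_smul, smul_eq_mul, LinearMap.comp_apply, LinearMap.mulLeft_apply]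
    rw [h2]
    exact sum_mem fun a _ => sum_mem fun b _ =>
      mul_mem (mul_mem (const_mem_zetaSeq _) (hpair a b)) (ih _)

theorem linearMap_wedgeSum_mem_zetaSeq
    (hsingle : ∀ a, (fun N : ℕ => ∑ k ∈ Icc 1 N, v k a) ∈ zetaSeq)
    (hpair : ∀ a b, (fun N : ℕ => ∑ k ∈ Icc 1 N, ∑ l ∈ Icc 1 k,
      (v k a * v l b - v k b * v l a)) ∈ zetaSeq)
    (p : ℕ) (Φ : ExteriorAlgebra ℚ (ι' → ℚ) →ₗ[ℚ] ℚ) :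
    (fun N => Φ (wedgeSum v p N)) ∈ zetaSeq := by
  obtain ⟨q, hq⟩ : ∃ q, p = 2 * q ∨ p = 2 * q + 1 := ⟨p / 2, by omega⟩
  have hne : (q.factorial : ℚ) ≠ 0 := by positivity
  rcases hq with rfl | rfl
  · have h : ∀ N, wedgeSum v (2 * q) N = (q.factorial : ℚ)⁻¹ • wedgePairSum v N ^ q := fun N => by
      rw [← (wedgeSum_eq v q N).1, smul_smul, inv_mul_cancel₀ hne, one_smul]
    simp only [h]
    exact linearMap_wedgePairSum_pow_mem_zetaSeq hpair q (Φ ∘ₗ LinearMap.lsmul ℚ _ _)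
  · have h : (fun N => Φ (wedgeSum v (2 * q + 1) N)) = ∑ a, (fun N : ℕ => ∑ k ∈ Icc 1 N, v k a) *
        fun N => ((q.factorial : ℚ)⁻¹ • Φ ∘ₗ LinearMap.mulLeft ℚ
          (ι ℚ (Pi.single a (1 : ℚ) : ι' → ℚ))) (wedgePairSum v N ^ q) := by
      funext N
      have h1 : wedgeSum v (2 * q + 1) N =
          (q.factorial : ℚ)⁻¹ • (ι ℚ (∑ l ∈ Icc 1 N, v l) * wedgePairSum v N ^ q) := by
        rw [← (wedgeSum_eq v q N).2, smul_smul, inv_mul_cancel₀ hne, one_smul]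
      rw [h1, ι_eq_sum_single, sum_mul, map_smul, map_sum, smul_sum, Finset.sum_apply]
      refine sum_congr rfl fun a _ => ?_
      simp only [smul_mul_assoc, map_smul, Pi.mul_apply, Finset.sum_apply, LinearMap.smul_apply,
        LinearMap.comp_apply, LinearMap.mulLeft_apply, smul_eq_mul]
      ring
    rw [h]
    exact sum_mem fun a _ => mul_mem (hsingle a)
      (linearMap_wedgePairSum_pow_mem_zetaSeq hpair q _)

theorem alternatingMap_sum_antitoneBox_mem_zetaSeq
    (hsingle : ∀ a, (fun N : ℕ => ∑ k ∈ Icc 1 N, v k a) ∈ zetaSeq)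
    (hpair : ∀ a b, (fun N : ℕ => ∑ k ∈ Icc 1 N, ∑ l ∈ Icc 1 k,
      (v k a * v l b - v k b * v l a)) ∈ zetaSeq)
    {p : ℕ} (M : (ι' → ℚ) [⋀^Fin p]→ₗ[ℚ] ℚ) :
    (fun N => ∑ k ∈ antitoneBox p N, M fun i => v (k i)) ∈ zetaSeq := by
  -- `liftAlternating` takes a form in every degree; here it is `M` in degree `p` and zero
  -- elsewhere.
  have h := linearMap_wedgeSum_mem_zetaSeq hsingle hpair p (liftAlternating (Pi.single p M))
  simpa only [wedgeSum_eq_sum_antitoneBox, map_sum, liftAlternating_apply_ιMulti,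
    Pi.single_eq_same] using h

end WedgeSumLimit

/-! ### Polynomials as multilinear forms in vectors of powers -/

section Polarization

open Finset MvPolynomial

variable {p d : ℕ}

/-- The multilinear map which sends the vectors of powers `(x_i ^ a)_a` to `P (x)`, for a
polynomial `P` of degree less than `d` in each variable. -/
noncomputable def polarization (d : ℕ) (P : MvPolynomial (Fin p) ℚ) :
    MultilinearMap ℚ (fun _ : Fin p => Fin d → ℚ) ℚ :=
  ∑ a : Fin p → Fin d, P.coeff (Finsupp.equivFunOnFinite.symm fun i => (a i : ℕ)) •
    (MultilinearMap.mkPiAlgebra ℚ (Fin p) ℚ).compLinearMap fun i => LinearMap.proj (a i)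

theorem polarization_apply (P : MvPolynomial (Fin p) ℚ) (v : Fin p → Fin d → ℚ) :
    polarization d P v = ∑ a : Fin p → Fin d,
      P.coeff (Finsupp.equivFunOnFinite.symm fun i => (a i : ℕ)) * ∏ i, v i (a i) := by
  simp [polarization]

theorem polarization_pow {P : MvPolynomial (Fin p) ℚ} (hd : ∀ i, P.degreeOf i < d)
    (x : Fin p → ℚ) : polarization d P (fun i a => x i ^ (a : ℕ)) = eval x P := by
  have hinj : Function.Injective fun a : Fin p → Fin d =>
      (Finsupp.equivFunOnFinite.symm fun i => (a i : ℕ) : Fin p →₀ ℕ) := by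
    intro a b h
    funext i
    exact Fin.ext (congrFun (Finsupp.equivFunOnFinite.symm.injective h) i)
  rw [polarization_apply, eval_eq']
  symm
  rw [sum_subset (s₂ := univ.image fun a : Fin p → Fin d =>
    (Finsupp.equivFunOnFinite.symm fun i => (a i : ℕ) : Fin p →₀ ℕ))]
  · rw [sum_image fun a _ b _ h => hinj h]
    simp
  · intro m hm
    refine mem_image.2 ⟨fun i => ⟨m i, ?_⟩, mem_univ _, by ext; simp⟩
    exact (monomial_le_degreeOf i hm).trans_lt (hd i)
  · intro m _ hm
    rw [notMem_support_iff.1 hm, zero_mul]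

/-- The polarization of an alternating polynomial, as an alternating map. -/
noncomputable def alternatingPolarization (d : ℕ) (P : MvPolynomial (Fin p) ℚ)
    (hP : ∀ σ : Equiv.Perm (Fin p), rename σ P = ((Equiv.Perm.sign σ : ℤˣ) : ℤ) • P) :
    (Fin d → ℚ) [⋀^Fin p]→ₗ[ℚ] ℚ where
  __ := polarization d P
  map_eq_zero_of_eq' v i j hv hij := by
    change polarization d P v = 0
    set σ := Equiv.swap i j with hσ
    have hvσ : ∀ k, v (σ k) = v k := by
      intro k
      rw [hσ, Equiv.swap_apply_def]
      split_ifs with h1 h2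
      · rw [h1, hv]
      · rw [h2, hv]
      · rfl
    have hc : ∀ a : Fin p → Fin d,
        P.coeff (Finsupp.equivFunOnFinite.symm fun i => (a (σ i) : ℕ)) =
          -P.coeff (Finsupp.equivFunOnFinite.symm fun i => (a i : ℕ)) := by
      intro a
      have h1 := coeff_rename_mapDomain σ σ.injective P
        (Finsupp.equivFunOnFinite.symm fun i => (a (σ i) : ℕ))
      have h2 : (Finsupp.equivFunOnFinite.symm fun i => (a (σ i) : ℕ)).mapDomain σ =
          Finsupp.equivFunOnFinite.symm fun i => (a i : ℕ) := by
        ext k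
        rw [Finsupp.mapDomain_equiv_apply]
        simp
      rw [h2, hP, Equiv.Perm.sign_swap hij] at h1
      rw [← h1]
      simp
    -- Reindexing by the swap negates the coefficients and preserves the products, as the two
    -- swapped vectors are equal.
    have h : polarization d P v = -polarization d P v := by
      conv_lhs => rw [polarization_apply, ← (Equiv.arrowCongr σ (Equiv.refl (Fin d))).sum_comp]
      rw [polarization_apply, ← sum_neg_distrib]
      refine sum_congr rfl fun a _ => ?_
      have hs : σ.symm = σ := Equiv.symm_swap i j
      have h1 : ∀ k, (Equiv.arrowCongr σ (Equiv.refl (Fin d))) a k = a (σ k) := by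
        intro k
        simp [Equiv.arrowCongr_apply, hs]
      simp only [h1, hc]
      rw [neg_mul, ← Equiv.prod_comp σ fun k => v k (a k)]
      simp only [hvσ]
    linarith

/-- `P` already lies in the `ε`-eigenspace of each reflection `x_j ↦ -x_j - n`, so projecting the
vector of powers onto that eigenspace does not change the value. -/
theorem polarization_symmetrized_pow {P : MvPolynomial (Fin p) ℚ} (hd : ∀ i, P.degreeOf i < d)
    {ε n : ℚ} (hε : ε * ε = 1)
    (hP : ∀ (x : Fin p → ℚ) j, eval (Function.update x j (-x j - n)) P = ε * eval x P)
    (x : Fin p → ℚ) :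
    polarization d P (fun i a => 1 / 2 * (x i ^ (a : ℕ) + ε * (-x i - n) ^ (a : ℕ))) =
      eval x P := by
  -- The variables are symmetrized one at a time, `s` being the set of those already done. The point
  -- `x` stays arbitrary since the induction hypothesis is also needed at the reflected point.
  have key : ∀ (s : Finset (Fin p)) (x : Fin p → ℚ),
      polarization d P (fun i a => if i ∈ s then
        1 / 2 * (x i ^ (a : ℕ) + ε * (-x i - n) ^ (a : ℕ)) else x i ^ (a : ℕ)) = eval x P := by
    intro s
    induction s using Finset.induction_on with
    | empty => intro x; simpa using polarization_pow hd x
    | insert j s hj ih =>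
      intro x
      have h1 := ih (Function.update x j (-x j - n))
      rw [hP, ← ih x] at h1
      set w : (Fin p → ℚ) → Fin p → Fin d → ℚ := fun x i a => if i ∈ s then
        1 / 2 * (x i ^ (a : ℕ) + ε * (-x i - n) ^ (a : ℕ)) else x i ^ (a : ℕ) with hw
      have h2 : (fun i a => if i ∈ insert j s then
          1 / 2 * (x i ^ (a : ℕ) + ε * (-x i - n) ^ (a : ℕ)) else x i ^ (a : ℕ) :
            Fin p → Fin d → ℚ) =
          Function.update (w x) j ((1 / 2 : ℚ) • ((fun a : Fin d => x j ^ (a : ℕ)) +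
            ε • fun a : Fin d => (-x j - n) ^ (a : ℕ))) := by
        funext i a
        rcases eq_or_ne i j with rfl | h
        · simp [mul_add]
        · simp [h, hw]
      have h3 : Function.update (w x) j (fun a : Fin d => x j ^ (a : ℕ)) = w x := by
        rw [Function.update_eq_self_iff]
        funext a
        simp [hw, hj]
      have h4 : Function.update (w x) j (fun a : Fin d => (-x j - n) ^ (a : ℕ)) =
          w (Function.update x j (-x j - n)) := by
        funext i a
        rcases eq_or_ne i j with rfl | h
        · simp [hw, hj]
        · simp [h, hw]
      rw [h2, MultilinearMap.map_update_smul, MultilinearMap.map_update_add,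
        MultilinearMap.map_update_smul, h3, h4, h1, ih x, smul_eq_mul, smul_eq_mul, ← mul_assoc,
        hε]
      ring
  simpa using key univ x

end Polarization

/-! ### Absolute convergence and exhaustion by boxes -/

section Summability

open Finset Filter Topology Polynomial

theorem summable_pi_prod_of_nonneg {p : ℕ} {g : Fin p → ℕ → ℝ} (hg : ∀ i k, 0 ≤ g i k)
    (hs : ∀ i, Summable (g i)) : Summable fun k : Fin p → ℕ => ∏ i, g i (k i) := by
  refine summable_of_sum_le (c := ∏ i, ∑' k, g i k)
    (fun k => prod_nonneg fun i _ => hg i (k i)) fun u => ?_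
  classical
  set B : Fin p → Finset ℕ := fun i => u.image fun k => k i
  calc ∑ k ∈ u, ∏ i, g i (k i) ≤ ∑ k ∈ Fintype.piFinset B, ∏ i, g i (k i) := by
        refine sum_le_sum_of_subset_of_nonneg (fun k hk => ?_)
          fun k _ _ => prod_nonneg fun i _ => hg i (k i)
        exact Fintype.mem_piFinset.2 fun i => mem_image_of_mem _ hk
    _ = ∏ i, ∑ k ∈ B i, g i k := (prod_univ_sum _ _).symm
    _ ≤ ∏ i, ∑' k, g i k := prod_le_prod (fun i _ => sum_nonneg fun k _ => hg i k)
        fun i _ => (hs i).sum_le_tsum _ fun k _ => hg i k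

theorem IsFrac.summable_norm {m r : ℕ} {f : ℚ → ℚ} (hf : IsFrac m r 2 f) :
    Summable fun k : ℕ => ‖((f ((k + m : ℕ) : ℚ) : ℚ) : ℂ)‖ := by
  obtain ⟨U, hU, hfU⟩ := hf
  have hO : (fun x => (X ^ 2 * U).eval x) =O[atTop] fun x => (centralPoly m ^ r).eval x := by
    refine isBigO_atTop_of_degree_le _ _ (degree_le_natDegree.trans ?_)
    rw [degree_eq_natDegree ((centralPoly_monic m).pow r).ne_zero, Nat.cast_le,
      (centralPoly_monic m).natDegree_pow, centralPoly_natDegree]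
    have := natDegree_mul_le (p := X ^ 2) (q := U)
    rw [natDegree_X_pow] at this
    omega
  have hf2 : f =O[atTop] fun x : ℚ => (x ^ 2)⁻¹ := by
    have h := (Asymptotics.isBigO_refl (fun x : ℚ => (x ^ 2)⁻¹ *
      ((centralPoly m ^ r).eval x)⁻¹) atTop).mul hO
    refine h.congr' ?_ ?_
    · filter_upwards [eventually_gt_atTop (m : ℚ)] with x hx
      have hx0 : x ≠ 0 := (lt_of_le_of_lt (Nat.cast_nonneg m) hx).ne'
      rw [hfU x (centralPoly_eval_ne_zero_of_lt hx), eval_pow, eval_mul, eval_pow, eval_X]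
      field_simp
    · filter_upwards [eventually_gt_atTop (m : ℚ)] with x hx
      rw [eval_pow, mul_assoc, inv_mul_cancel₀
        (pow_ne_zero _ (centralPoly_eval_ne_zero_of_lt hx)), mul_one]
  have hN : (fun N : ℕ => f N) =O[atTop] fun N : ℕ => ((N : ℚ) ^ 2)⁻¹ :=
    hf2.comp_tendsto tendsto_natCast_atTop_atTop
  have hs : Summable fun N : ℕ => ‖((N : ℚ) ^ 2)⁻¹‖ := by
    have := (Real.summable_nat_pow_inv (p := 2)).2 (by norm_num)
    refine this.congr fun N => ?_
    rw [← Rat.norm_cast_real]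
    simp
  have h := (summable_nat_add_iff m).2 (summable_of_isBigO_nat hs hN.norm_norm)
  refine h.congr fun k => ?_
  rw [← Rat.norm_cast_real, ← Complex.norm_real]
  simp

theorem tendsto_sum_antitoneBox {p : ℕ} {F : (Fin p → ℕ) → ℂ} (hF : Summable F) :
    ∃ z, HasSum (fun k : orderedTuples p => F k) z ∧
      Tendsto (fun N => ∑ k ∈ antitoneBox p N, F k) atTop (𝓝 z) := by
  classical
  have h := (hF.subtype (orderedTuples p)).hasSum
  refine ⟨_, h, ?_⟩
  have h1 := (hasSum_subtype_iff_indicator (s := orderedTuples p)).1 h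
  -- The boxes `[0, N] ^ p` exhaust all tuples: `∑ i, k i` bounds every coordinate of `k`.
  have ht : Tendsto (fun N : ℕ => Fintype.piFinset fun _ : Fin p => range (N + 1)) atTop atTop := by
    refine tendsto_atTop_finset_of_monotone (fun a b hab => ?_) fun k => ⟨∑ i, k i, ?_⟩
    · exact Fintype.piFinset_subset _ _ fun _ => range_subset_range.2 (by omega)
    · simp only [Fintype.mem_piFinset, mem_range]
      intro i
      have := single_le_sum (f := k) (fun _ _ => Nat.zero_le _) (mem_univ i)
      omega
  refine (h1.comp ht).congr fun N => ?_
  simp only [Function.comp_apply]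
  symm
  have hsub : antitoneBox p N ⊆ Fintype.piFinset fun _ : Fin p => range (N + 1) := by
    intro k hk
    rw [mem_antitoneBox] at hk
    simp only [Fintype.mem_piFinset, mem_range]
    intro i
    have := (hk.1 i).2
    omega
  rw [← sum_subset hsub]
  · refine sum_congr rfl fun k hk => ?_
    rw [mem_antitoneBox] at hk
    rw [Set.indicator_of_mem]
    exact ⟨hk.2, fun i => (hk.1 i).1⟩
  · intro k hk hk'
    refine Set.indicator_of_notMem ?_ _
    rintro ⟨h1, h2⟩
    refine hk' (mem_antitoneBox.2 ⟨fun i => ⟨h2 i, ?_⟩, h1⟩)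
    have := Fintype.mem_piFinset.1 hk i
    rw [mem_range] at this
    omega

end Summability

/-! ### The odd one-variable fractions -/

section SymmetrizedPowers

open Polynomial Finset

theorem ascPochhammer_eval_eq_prod_range (n : ℕ) (x : ℚ) :
    (ascPochhammer ℚ n).eval x = ∏ i ∈ range n, (x + i) := by
  induction n with
  | zero => simp
  | succ n ih => rw [ascPochhammer_succ_eval, ih, prod_range_succ]

theorem centralPoly_eval_add (m : ℕ) (x : ℚ) :
    (centralPoly m).eval (x + m) = (ascPochhammer ℚ (2 * m + 1)).eval x := by
  rw [centralPoly_eval, ascPochhammer_eval_eq_prod_range]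
  refine prod_nbij' (fun j => (m - j).toNat) (fun i => (m : ℤ) - i) ?_ ?_ ?_ ?_ ?_
  all_goals simp only [mem_Icc, mem_range]
  all_goals intro j hj
  · omega
  · omega
  · omega
  · omega
  · have h : (((m - j).toNat : ℕ) : ℤ) = m - j := Int.toNat_of_nonneg (by omega)
    have h' : (((m - j).toNat : ℕ) : ℚ) = m - j := by exact_mod_cast h
    rw [h']
    ring

/-- The part of `y ^ a / (y (y + 1) ⋯ (y + 2 m)) ^ A` which has the symmetry `ε` in its numerator,
where `y = x - m`. -/
noncomputable def symmetrizedPow (m A : ℕ) (ε : ℚ) (a : ℕ) (x : ℚ) : ℚ :=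
  1 / 2 * ((x - m) ^ a + ε * (-(x - m) - (2 * m : ℕ)) ^ a) / (centralPoly m).eval x ^ A

theorem symmetrizedPow_isFrac {m A a : ℕ} (ε : ℚ) (ha : a + 2 ≤ A * (2 * m + 1)) :
    IsFrac m A 2 (symmetrizedPow m A ε a) := by
  refine ⟨C (1 / 2) * ((X - C (m : ℚ)) ^ a + C ε * (C (-1) * (X + C (m : ℚ))) ^ a), ?_,
    fun x _ => ?_⟩
  · refine le_trans (Nat.add_le_add_right ?_ 2) ha
    refine (natDegree_C_mul_le _ _).trans ((natDegree_add_le _ _).trans (max_le ?_ ?_))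
    · rw [natDegree_pow, natDegree_X_sub_C, mul_one]
    · refine (natDegree_C_mul_le _ _).trans (natDegree_pow_le.trans ?_)
      exact (Nat.mul_le_mul_left a ((natDegree_C_mul_le _ _).trans (natDegree_X_add_C _).le)).trans
        (by rw [mul_one])
  · rw [symmetrizedPow]
    simp only [eval_add, eval_mul, eval_pow, eval_sub, eval_X, eval_C]
    push_cast
    ring_nf

/-- In terms of `y = x - m`, the map `x ↦ -x` is `y ↦ -y - 2 m`. It multiplies the numerator by `ε`
and, the central polynomial being odd, the denominator by `(-1) ^ A`. -/
theorem symmetrizedPow_neg {m A a : ℕ} {ε : ℚ} (hε : ε * ε = 1) (hεA : ε * (-1) ^ A = -1) (x : ℚ) :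
    symmetrizedPow m A ε a (-x) = -symmetrizedPow m A ε a x := by
  have h1 : ((-1 : ℚ) ^ A)⁻¹ = (-1) ^ A := by rw [← inv_pow]; norm_num
  unfold symmetrizedPow
  rw [centralPoly_eval_neg, ← neg_one_mul (eval x _), mul_pow, div_eq_mul_inv, mul_inv, h1]
  have h2 : -x - (m : ℚ) = -(x - m) - (2 * m : ℕ) := by push_cast; ring
  have h3 : -(-(x - (m : ℚ)) - (2 * m : ℕ)) - (2 * m : ℕ) = x - m := by ring
  rw [h2, h3]
  linear_combination (1 / 2 * ((x - (m : ℚ)) ^ a + ε * (-(x - m) - (2 * m : ℕ)) ^ a) *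
    (eval x (centralPoly m) ^ A)⁻¹) * hεA - 1 / 2 * (-(x - (m : ℚ)) - (2 * m : ℕ)) ^ a * (-1) ^ A *
      (eval x (centralPoly m) ^ A)⁻¹ * hε

end SymmetrizedPowers

/-! ### The general term as a form in the odd fractions -/

section SeriesTerm

open MvPolynomial Finset

theorem eval_update_of_mem_wellPoisedPolynomials {n A p : ℕ} {P : MvPolynomial (Fin p) ℚ}
    (hP : P ∈ wellPoisedPolynomials n A p) (x : Fin p → ℚ) (j : Fin p) :
    eval (Function.update x j (-x j - n)) P = (-1) ^ (A * (n + 1) + 1) * eval x P := by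
  have h := congrArg (eval x) (hP.2 j)
  rw [map_mul, map_pow, map_neg, map_one] at h
  rw [← h]
  have h2 := eval₂Hom_bind₁ (RingHom.id ℚ) x
    (Function.update (X : Fin p → MvPolynomial (Fin p) ℚ) j (-X j - C (n : ℚ))) P
  refine Eq.trans ?_ h2.symm
  change eval _ P = eval _ P
  congr 2
  funext i
  rcases eq_or_ne i j with rfl | h
  · simp
  · simp [h]

/-- Multilinearity pulls out the denominators, and `polarization_symmetrized_pow` evaluates what
remains. -/
theorem seriesTerm_eq_polarization {m A p d : ℕ} {P : MvPolynomial (Fin p) ℚ}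
    (hP : P ∈ wellPoisedPolynomials (2 * m) A p) (hd : ∀ i, P.degreeOf i < d) (k : Fin p → ℕ) :
    seriesTerm (2 * m) A p P k = ((polarization d P fun i a =>
      symmetrizedPow m A ((-1) ^ (A * (2 * m + 1) + 1)) a ((k i + m : ℕ) : ℚ) : ℚ) : ℂ) := by
  have h : (fun (i : Fin p) (a : Fin d) =>
      symmetrizedPow m A ((-1) ^ (A * (2 * m + 1) + 1)) a ((k i + m : ℕ) : ℚ)) = fun i =>
      ((ascPochhammer ℚ (2 * m + 1)).eval (k i : ℚ) ^ A)⁻¹ • fun a : Fin d =>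
        1 / 2 * ((k i : ℚ) ^ (a : ℕ) +
          (-1) ^ (A * (2 * m + 1) + 1) * (-(k i : ℚ) - (2 * m : ℕ)) ^ (a : ℕ)) := by
    funext i a
    rw [symmetrizedPow, Nat.cast_add, centralPoly_eval_add, add_sub_cancel_right, Pi.smul_apply,
      smul_eq_mul, div_eq_inv_mul]
  rw [h, MultilinearMap.map_smul_univ, polarization_symmetrized_pow hd
    (by rw [← mul_pow]; simp) (eval_update_of_mem_wellPoisedPolynomials hP) fun i => (k i : ℚ)]
  rw [seriesTerm, div_eq_inv_mul, smul_eq_mul, Rat.cast_mul, ← prod_inv_distrib, Rat.cast_prod]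
  congr 1
  · refine prod_congr rfl fun i _ => ?_
    have h1 := ascPochhammer_eval₂ (algebraMap ℚ ℂ) (2 * m + 1) (algebraMap ℚ ℂ (k i : ℚ))
    rw [Polynomial.eval₂_at_apply] at h1
    simp only [eq_ratCast, Rat.cast_natCast] at h1
    rw [Rat.cast_inv, Rat.cast_pow, h1]
  · have h1 := aeval_algebraMap_apply (B := ℂ) (fun i => (k i : ℚ)) P
    simpa [aeval_eq_eval, Function.comp_def] using h1

/-- Summability holds over all tuples, ordered or not: the term is a finite combination of products
of absolutely summable one-variable terms. -/
theorem summable_polarization {p d m : ℕ} (P : MvPolynomial (Fin p) ℚ) {f : Fin d → ℚ → ℚ}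
    {r : ℕ} (hf : ∀ a, IsFrac m r 2 (f a)) :
    Summable fun k : Fin p → ℕ =>
      ((polarization d P fun i a => f a ((k i + m : ℕ) : ℚ) : ℚ) : ℂ) := by
  simp only [polarization_apply, Rat.cast_sum, Rat.cast_mul, Rat.cast_prod]
  refine summable_sum fun a _ => Summable.mul_left _ (Summable.of_norm ?_)
  simp only [norm_prod]
  exact summable_pi_prod_of_nonneg (g := fun i k => ‖((f (a i) ((k + m : ℕ) : ℚ) : ℚ) : ℂ)‖)
    (fun _ _ => norm_nonneg _) fun i => (hf (a i)).summable_norm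

end SeriesTerm

/-! ### Conclusion -/

theorem mainTheorem8 (n A p : ℕ) (hn : Even n) (hA : 1 ≤ A) (hA2 : A ≤ 2) (hp : 1 ≤ p)
    (P : MvPolynomial (Fin p) ℚ) (hP : P ∈ wellPoisedPolynomials n A p)
    (hdeg : P ≠ 0 → ∀ j : Fin p, (P.degreeOf j : ℤ) ≤ (A : ℤ) * ((n : ℤ) + 1) - 2) :
    ∃ Q : Polynomial ℚ,
      HasSum (fun k : orderedTuples p => seriesTerm n A p P (k : Fin p → ℕ))
        (Polynomial.aeval (riemannZeta 3) Q) := by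
  rcases eq_or_ne P 0 with rfl | hP0
  · refine ⟨0, ?_⟩
    simp [seriesTerm]
  obtain ⟨m, rfl⟩ := hn.exists_two_nsmul
  rw [smul_eq_mul] at *
  have hdeg' : ∀ j, P.degreeOf j + 2 ≤ A * (2 * m + 1) := by
    intro j
    have := hdeg hP0 j
    zify
    push_cast at this
    linarith
  set d := A * (2 * m + 1) - 1 with hd
  have hPd : ∀ j, P.degreeOf j < d := fun j => by have := hdeg' j; omega
  set ε : ℚ := (-1) ^ (A * (2 * m + 1) + 1) with hε
  have hε2 : ε * ε = 1 := by rw [hε, ← mul_pow]; simp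
  -- The total exponent is `2 (A m + A) + 1`; this is the parity that makes the fractions odd.
  have hεA : ε * (-1) ^ A = -1 := by
    rw [hε, ← pow_add, Odd.neg_one_pow]
    exact ⟨A * m + A, by ring⟩
  set f : Fin d → ℚ → ℚ := fun a => symmetrizedPow m A ε a
  have hf : ∀ a, IsFrac m A 2 (f a) := fun a =>
    symmetrizedPow_isFrac ε (by have := a.2; omega)
  -- Here `A ≤ 2` enters: it bounds the order of the poles by two.
  have hprim : ∀ a, HasPrimitive m 2 (f a) := fun a =>
    ((hf a).mono hA2).hasPrimitive_of_odd fun x _ => symmetrizedPow_neg hε2 hεA x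
  have hgood := alternatingMap_sum_antitoneBox_mem_zetaSeq
    (v := fun k a => f a ((k + m : ℕ) : ℚ)) (fun a => (hprim a).sum_mem_zetaSeq)
    (fun a b => (hprim a).antisymm_pair_sum_mem_zetaSeq (hprim b))
    (alternatingPolarization d P hP.1)
  obtain ⟨z, hz, hlim⟩ := hgood
  obtain ⟨z', hsum, hlim'⟩ := tendsto_sum_antitoneBox (summable_polarization P hf)
  have hzz : z' = z := by
    refine tendsto_nhds_unique hlim' (hlim.congr fun N => ?_)
    rw [Rat.cast_sum]
    rfl
  rw [Algebra.adjoin_singleton_eq_range_aeval] at hz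
  obtain ⟨Q, hQ⟩ := hz
  refine ⟨Q, ?_⟩
  have hQ' : Polynomial.aeval (riemannZeta 3) Q = z' := hQ.trans hzz.symm
  rw [hQ']
  refine hsum.congr_fun fun k => ?_
  exact seriesTerm_eq_polarization hP hPd k
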